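/- Let $n\ge 1$. For $A\subset\mathbb{R}^n$ of finite Lebesgue measure let $A^{*}$ be the open ball centred at $0$ with $|A^{*}|=|A|$. Call a measurable function $f:\mathbb{R}^n\to[0,\infty]$ vanishing at infinity if $|\{f>t\}|<\infty$ for all $t>0$, and for such $f$ let $f^{*}(x)=\int_0^\infty \chi_{\{f>t\}^{*}}(x)\,dt$ be its symmetric decreasing rearrangement. For $y_1,\dots,y_{n+1}\in\mathbb{R}^n$ put $\det(y_1,\dots,y_{n+1}):=n!\,\mathrm{vol}(\mathrm{co}\{y_1,\dots,y_{n+1}\})$. Below, $0\cdot\infty=0$. **Theorem 2.5.** (i) Let $f_1,\dots,f_n$ be nonnegative measurable functions on $\mathbb{R}^n$ vanishing at infinity and let $A=(a_{ij})\in \mathrm{GL}_n(\mathbb{R})$. Then $$\operatorname*{ess\,sup}_{y_1,\dots,y_n\in\mathbb{R}^n}\ \prod_{j=1}^{n} f_{j}^{*}\Big(\sum_{i=1}^{n}a_{ij}y_{i}\Big)\det(0,y_{1},\dots,y_{n})\ \le\ \operatorname*{ess\,sup}_{y_1,\dots,y_n\in\mathbb{R}^n}\ \prod_{j=1}^{n}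 f_{j}\Big(\sum_{i=1}^{n}a_{ij}y_{i}\Big)\det(0,y_{1},\dots,y_{n}).$$ (ii) Let $f_1,\dots,f_{n+1}$ be nonnegative measurable functions on $\mathbb{R}^n$ vanishing at infinity and let $A=(a_{ij})\in \mathrm{GL}_{n+1}(\mathbb{R})$. Then $$\operatorname*{ess\,sup}_{y_1,\dots,y_{n+1}\in\mathbb{R}^n}\ \prod_{j=1}^{n+1} f_{j}^{*}\Big(\sum_{i=1}^{n+1}a_{ij}y_{i}\Big)\det(y_{1},\dots,y_{n+1})\ \le\ \operatorname*{ess\,sup}_{y_1,\dots,y_{n+1}\in\mathbb{R}^n}\ \prod_{j=1}^{n+1} f_{j}\Big(\sum_{i=1}^{n+1}a_{ij}y_{i}\Big)\det(y_{1},\dots,y_{n+1}).$$ (iii) In particular ($A=I$), for nonnegative measurable functions $f_j$ on $\mathbb{R}^n$ vanishing at infinity, $$\operatorname*{ess\,sup}_{y_1,\dots,y_n}\ \prod_{j=1}^{n} f_{j}^{*}(y_{j})\det(0,y_{1},\dots,y_{n})\ \le\ \operatorname*{ess\,sup}_{y_1,\dots,y_n}\ \prod_{j=1}^{n} f_{j}(y_{j})\det(0,y_{1},\dots,y_{n}),$$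 $$\operatorname*{ess\,sup}_{y_1,\dots,y_{n+1}}\ \prod_{j=1}^{n+1} f_{j}^{*}(y_{j})\det(y_{1},\dots,y_{n+1})\ \le\ \operatorname*{ess\,sup}_{y_1,\dots,y_{n+1}}\ \prod_{j=1}^{n+1} f_{j}(y_{j})\det(y_{1},\dots,y_{n+1}).$$ -/

import Mathlib

open MeasureTheory
open scoped ENNReal

/-- The symmetric rearrangement of a set `A ⊆ ℝⁿ` of finite Lebesgue measure: the open ball centred
at `0` of radius `r`, where `vₙ * r ^ n = |A|` and `vₙ` is the volume of the unit ball.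
(Only used for `1 ≤ n` and `|A| < ∞`; see `volume_symmRearrSet`.) -/
noncomputable def symmRearrSet {n : ℕ} (A : Set (EuclideanSpace ℝ (Fin n))) :
    Set (EuclideanSpace ℝ (Fin n)) :=
  Metric.ball 0
    (((volume A).toReal / (volume (Metric.ball (0 : EuclideanSpace ℝ (Fin n)) 1)).toReal)
      ^ (1 / (n : ℝ)))

/-- The rearranged set has the same measure as the original one. -/
theorem volume_symmRearrSet {n : ℕ} (hn : 1 ≤ n) (A : Set (EuclideanSpace ℝ (Fin n)))
    (hA : volume A < ∞) : volume (symmRearrSet A) = volume A := by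
  have hn0 : (n : ℝ) ≠ 0 := by exact_mod_cast (by omega : n ≠ 0)
  have : Nonempty (Fin n) := ⟨⟨0, hn⟩⟩
  set B := Metric.ball (0 : EuclideanSpace ℝ (Fin n)) 1
  have hB : 0 < (volume B).toReal :=
    ENNReal.toReal_pos (Metric.measure_ball_pos volume _ one_pos).ne' measure_ball_lt_top.ne
  have hq : 0 ≤ (volume A).toReal / (volume B).toReal := by positivity
  rw [symmRearrSet, Measure.addHaar_ball _ _ (Real.rpow_nonneg hq _), finrank_euclideanSpace_fin,
    ← Real.rpow_natCast, ← Real.rpow_mul hq, one_div_mul_cancel hn0, Real.rpow_one,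
    ENNReal.ofReal_div_of_pos hB, ENNReal.ofReal_toReal hA.ne,
    ENNReal.ofReal_toReal measure_ball_lt_top.ne]
  exact ENNReal.div_mul_cancel (Metric.measure_ball_pos volume _ one_pos).ne'
    measure_ball_lt_top.ne

/-- The symmetric decreasing rearrangement `f* (x) = ∫₀^∞ χ_{{f > t}*} (x) dt` of a function
`f : ℝⁿ → [0, ∞]`. It may be infinite at points, for instance at `0` when `f` is unbounded. -/
noncomputable def symmDecrRearr {n : ℕ} (f : EuclideanSpace ℝ (Fin n) → ℝ≥0∞) :
    EuclideanSpace ℝ (Fin n) → ℝ≥0∞ :=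
  fun x => ∫⁻ t in Set.Ioi (0 : ℝ),
    (symmRearrSet {y | ENNReal.ofReal t < f y}).indicator (fun _ => (1 : ℝ≥0∞)) x

/-- `f` vanishes at infinity: all its positive level sets have finite measure. -/
def VanishesAtInfinity {n : ℕ} (f : EuclideanSpace ℝ (Fin n) → ℝ≥0∞) : Prop :=
  ∀ t : ℝ, 0 < t → volume {x | ENNReal.ofReal t < f x} < ∞

/-- `det(y₁, …, yₙ₊₁) := n! vol(co{y₁, …, yₙ₊₁})` for points `y₁, …, yₙ₊₁` of `ℝⁿ`. -/
noncomputable def simplexDet {n : ℕ} (y : Fin (n + 1) → EuclideanSpace ℝ (Fin n)) : ℝ≥0∞ :=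
  (n.factorial : ℝ≥0∞) * volume (convexHull ℝ (Set.range y))

/-! Put `z = A y`. Up to a constant, the determinant becomes the absolute value of a continuous
function `P(z)`. Along any unit vector `u`, with the components orthogonal to `u` fixed, `P` is
linear in the heights of the points: translating all vertices does not change the simplex, and only
one row of a suitable determinant involves the heights.

A bound `|P| ≤ M` on a product of compact sets survives symmetrizing all of them along a common `u`
(`IsFiberLinear.abs_le_of_mem_fiberSymm`). Among all compact tuples with this bound, with large
enough volumes and inside a fixed ball, one maximizes the total volume inside the target balls. If
it failed to fill a ball, a further symmetrization would increase this volume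
(`exists_volume_inter_closedBall_lt_fiberSymm`), so the bound holds on the balls
(`IsFiberLinear.abs_le_of_mem_ball`).

Inner regularity extends this to measurable sets and a.e. bounds. Applied to level sets `{f_j >
t_j}` with `M = S / ∏ t_j`, it gives the functional inequality, even at every point. -/

open scoped RealInnerProductSpace

/-! ### Centred intervals on the line. -/

section OneDim

/-- `C'` contains the centred interval of length `diam C`. Of this interval and `[-l, l]`, one
contains the other, and `|C| ≤ diam C`. -/
theorem volume_inter_Icc_le_of_isCompact {C C' : Set ℝ} (hC : IsCompact C)
    (hC' : ∀ a ∈ C, ∀ b ∈ C, ∀ s, |s| ≤ (b - a) / 2 → s ∈ C') (l : ℝ) :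
    min (volume C) (volume (Set.Icc (-l) l)) ≤ volume (C' ∩ Set.Icc (-l) l) := by
  rcases C.eq_empty_or_nonempty with rfl | hne
  · simp
  obtain ⟨a, ha, haC⟩ := hC.exists_isLeast hne
  obtain ⟨b, hb, hbC⟩ := hC.exists_isGreatest hne
  rcases le_total l ((b - a) / 2) with h | h
  · exact (min_le_right _ _).trans (measure_mono (Set.subset_inter
      (fun s hs => hC' a ha b hb s ((abs_le.2 hs).trans h)) subset_rfl))
  · refine (min_le_left _ _).trans ?_
    calc volume C ≤ volume (Set.Icc a b) := measure_mono (show C ⊆ Set.Icc a b from fun x hx => ⟨haC hx, hbC hx⟩)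
      _ = volume (Set.Icc (-((b - a) / 2)) ((b - a) / 2)) := by
          rw [Real.volume_Icc, Real.volume_Icc]; congr 1; ring
      _ ≤ volume (C' ∩ Set.Icc (-l) l) := measure_mono fun s hs => ⟨hC' a ha b hb s (abs_le.2 hs),
          by linarith [hs.1], by linarith [hs.2]⟩

theorem setOf_add_sq_le_eq_Icc (c d : ℝ) :
    {s : ℝ | c + s ^ 2 ≤ d} = ∅ ∨ ∃ l, {s : ℝ | c + s ^ 2 ≤ d} = Set.Icc (-l) l := by
  rcases lt_or_ge d c with h | h
  · left
    ext s
    simp only [Set.mem_ofPred_eq, Set.mem_empty_iff_false, iff_false, not_le]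
    nlinarith [sq_nonneg s]
  · refine .inr ⟨√(d - c), ?_⟩
    ext s
    rw [Set.mem_ofPred_eq, Set.mem_Icc, ← abs_le, ← Real.sqrt_sq_eq_abs,
      Real.sqrt_le_sqrt_iff (by linarith)]
    constructor <;> intro <;> linarith

theorem min_volume_le_volume_inter_of_isCompact {C C' : Set ℝ} (hC : IsCompact C)
    (hC' : ∀ a ∈ C, ∀ b ∈ C, ∀ s, |s| ≤ (b - a) / 2 → s ∈ C') (c d : ℝ) :
    min (volume C) (volume {s : ℝ | c + s ^ 2 ≤ d}) ≤ volume (C' ∩ {s : ℝ | c + s ^ 2 ≤ d}) := by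
  rcases setOf_add_sq_le_eq_Icc c d with h | ⟨l, h⟩
  · simp [h]
  · rw [h]; exact volume_inter_Icc_le_of_isCompact hC hC' l

end OneDim

/-! ### Symmetrization along a direction. -/

section FiberSymm

variable {E : Type*} [NormedAddCommGroup E] [InnerProductSpace ℝ E]

/-- The set obtained from `K` by replacing every nonempty fiber `C` of `K` in the direction of the
unit vector `u` by the closed interval of length `diam C` that is centred on `uᗮ`. This is at least
as large as the Steiner symmetrization of `K`. -/
def fiberSymm (u : E) (K : Set E) : Set E :=
  (fun p : E × E × ℝ => p.1 - ⟪u, p.1⟫ • u + (p.2.2 * ((⟪u, p.1⟫ - ⟪u, p.2.1⟫) / 2)) • u) ''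
    ((K ×ˢ K ×ˢ Set.Icc (-1 : ℝ) 1) ∩
      {p | p.1 - ⟪u, p.1⟫ • u = p.2.1 - ⟪u, p.2.1⟫ • u})

theorem IsCompact.fiberSymm {K : Set E} (hK : IsCompact K) (u : E) :
    IsCompact (fiberSymm u K) := by
  refine IsCompact.image ((hK.prod (hK.prod isCompact_Icc)).inter_right ?_) (by fun_prop)
  exact isClosed_eq (by fun_prop) (by fun_prop)

theorem mem_fiberSymm_of_abs_le {u : E} (hu : ‖u‖ = 1) {K : Set E} {h : E} (hh : ⟪u, h⟫ = 0)
    {a b s : ℝ} (ha : h + a • u ∈ K) (hb : h + b • u ∈ K) (hs : |s| ≤ (b - a) / 2) :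
    h + s • u ∈ fiberSymm u K := by
  have huu : ⟪u, u⟫ = 1 := by rw [real_inner_self_eq_norm_sq, hu]; norm_num
  have key : ∀ r : ℝ, ⟪u, h + r • u⟫ = r := fun r => by
    rw [inner_add_right, inner_smul_right, hh, huu]; ring
  -- If `a = b`, the quotient is `0` by convention, which is right because then `s = 0`.
  refine ⟨(h + b • u, h + a • u, s / ((b - a) / 2)), ⟨⟨hb, ha, ?_⟩, ?_⟩, ?_⟩
  · rw [Set.mem_Icc, ← abs_le, abs_div]
    exact div_le_one_of_le₀ (hs.trans (le_abs_self _)) (abs_nonneg _)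
  · simp only [Set.mem_ofPred_eq, key]; abel
  · simp only [key]
    have : s / ((b - a) / 2) * ((b - a) / 2) = s := by
      rcases eq_or_ne ((b - a) / 2) 0 with h0 | h0
      · rw [h0] at hs ⊢
        rw [abs_nonpos_iff.1 hs]; simp
      · exact div_mul_cancel₀ _ h0
    rw [this]; abel

theorem exists_of_mem_fiberSymm {u : E} (hu : ‖u‖ = 1) {K : Set E} {p : E}
    (hp : p ∈ fiberSymm u K) :
    ∃ (h : E) (a b s : ℝ), ⟪u, h⟫ = 0 ∧ h + a • u ∈ K ∧ h + b • u ∈ K ∧ |s| ≤ (b - a) / 2 ∧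
      p = h + s • u := by
  have huu : ⟪u, u⟫ = 1 := by rw [real_inner_self_eq_norm_sq, hu]; norm_num
  obtain ⟨⟨x, y, θ⟩, ⟨⟨hx, hy, hθ⟩, hxy⟩, rfl⟩ := hp
  simp only [Set.mem_ofPred_eq] at hx hy hθ hxy
  have hh : ⟪u, x - ⟪u, x⟫ • u⟫ = 0 := by
    rw [inner_sub_right, inner_smul_right, huu]; ring
  have hx' : x - ⟪u, x⟫ • u + ⟪u, x⟫ • u ∈ K := by simpa using hx
  have hy' : x - ⟪u, x⟫ • u + ⟪u, y⟫ • u ∈ K := by rw [hxy]; simpa using hy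
  have hθ' : |θ| ≤ 1 := abs_le.2 hθ
  have hs : |θ * ((⟪u, x⟫ - ⟪u, y⟫) / 2)| ≤ |(⟪u, x⟫ - ⟪u, y⟫) / 2| := by
    rw [abs_mul]; exact mul_le_of_le_one_left (abs_nonneg _) hθ'
  rcases le_total ⟪u, y⟫ ⟪u, x⟫ with h | h
  · exact ⟨_, _, _, _, hh, hy', hx', hs.trans_eq (abs_of_nonneg (by linarith)), rfl⟩
  · refine ⟨_, _, _, _, hh, hx', hy', hs.trans_eq ?_, rfl⟩
    rw [abs_of_nonpos (by linarith)]; ring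

theorem norm_sq_add_smul_of_inner_eq_zero {u : E} (hu : ‖u‖ = 1) {h : E} (hh : ⟪u, h⟫ = 0)
    (s : ℝ) : ‖h + s • u‖ ^ 2 = ‖h‖ ^ 2 + s ^ 2 := by
  rw [norm_add_sq_real, inner_smul_right, real_inner_comm, hh, norm_smul, hu]
  simp

theorem fiberSymm_subset_closedBall {u : E} (hu : ‖u‖ = 1) {K : Set E} {R : ℝ}
    (hK : K ⊆ Metric.closedBall 0 R) : fiberSymm u K ⊆ Metric.closedBall 0 R := by
  intro p hp
  obtain ⟨h, a, b, s, hh, ha, hb, hs, rfl⟩ := exists_of_mem_fiberSymm hu hp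
  have ha' := mem_closedBall_zero_iff.1 (hK ha)
  have hb' := mem_closedBall_zero_iff.1 (hK hb)
  have hR : 0 ≤ R := (norm_nonneg _).trans ha'
  rw [mem_closedBall_zero_iff]
  rw [← pow_le_pow_iff_left₀ (norm_nonneg _) hR two_ne_zero,
    norm_sq_add_smul_of_inner_eq_zero hu hh] at ha' hb' ⊢
  have h1 := abs_le.1 hs
  -- `s² ≤ ((b - a)/2)² ≤ (a² + b²)/2`, the gap in the last step being `((a + b)/2)²`.
  nlinarith [sq_nonneg (a + b)]

/-- A function of finitely many points which depends linearly on the heights of these points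
above any hyperplane through the origin. -/
def IsFiberLinear {ι : Type*} [Fintype ι] (P : (ι → E) → ℝ) : Prop :=
  ∀ u : E, ‖u‖ = 1 → ∀ x : ι → E, (∀ j, ⟪u, x j⟫ = 0) →
    ∃ c : ι → ℝ, ∀ s : ι → ℝ, P (fun j => x j + s j • u) = ∑ j, c j * s j

/-- Choosing endpoints by the sign of `c j` gives the maximum and minimum of `∑ c j * s j` over the
box of the `[a j, b j]`. Both lie in `[-M, M]`, and their difference `∑ |c j| (b j - a j)` is at
least twice the absolute value at the centred heights. -/
theorem IsFiberLinear.abs_le_of_mem_fiberSymm {ι : Type*} [Fintype ι] {P : (ι → E) → ℝ}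
    (hP : IsFiberLinear P) {u : E} (hu : ‖u‖ = 1) {K : ι → Set E} {M : ℝ}
    (hM : ∀ z, (∀ j, z j ∈ K j) → |P z| ≤ M) {z : ι → E} (hz : ∀ j, z j ∈ fiberSymm u (K j)) :
    |P z| ≤ M := by
  choose h a b s hh ha hb hs hzs using fun j => exists_of_mem_fiberSymm hu (hz j)
  obtain ⟨c, hc⟩ := hP u hu h hh
  obtain rfl : z = fun j => h j + s j • u := funext hzs
  have h1 := hM (fun j => h j + (if 0 ≤ c j then b j else a j) • u)
    (fun j => by split_ifs; exacts [hb j, ha j])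
  have h2 := hM (fun j => h j + (if 0 ≤ c j then a j else b j) • u)
    (fun j => by split_ifs; exacts [ha j, hb j])
  rw [hc (fun j => if 0 ≤ c j then b j else a j)] at h1
  rw [hc (fun j => if 0 ≤ c j then a j else b j)] at h2
  rw [hc s]
  have h3 : 2 * |∑ j, c j * s j| ≤ ∑ j, c j * (if 0 ≤ c j then b j else a j) -
      ∑ j, c j * (if 0 ≤ c j then a j else b j) := by
    rw [← Finset.sum_sub_distrib]
    calc 2 * |∑ j, c j * s j| ≤ 2 * ∑ j, |c j * s j| := by
          gcongr; exact Finset.abs_sum_le_sum_abs _ _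
      _ = ∑ j, 2 * |c j * s j| := Finset.mul_sum _ _ _
      _ ≤ _ := by
          refine Finset.sum_le_sum fun j _ => ?_
          rw [abs_mul]
          have := hs j
          split_ifs with h0
          · rw [abs_of_nonneg h0]; nlinarith
          · rw [abs_of_neg (not_le.1 h0)]; nlinarith
  have h4 := abs_le.1 h1
  have h5 := abs_le.1 h2
  linarith

theorem isCompact_setOf_add_smul_mem {u : E} (hu : ‖u‖ = 1) {K : Set E} (hK : IsCompact K)
    (h : E) : IsCompact {s : ℝ | h + s • u ∈ K} := by
  have hcl : Topology.IsClosedEmbedding fun s : ℝ => h + s • u := by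
    have h1 : Topology.IsClosedEmbedding fun s : ℝ => s • u :=
      (Isometry.of_dist_eq fun s t => by
        rw [dist_eq_norm, ← sub_smul, norm_smul, hu, mul_one, dist_eq_norm]).isClosedEmbedding
    exact (Homeomorph.addLeft h).isClosedEmbedding.comp h1
  exact hcl.isCompact_preimage hK

theorem volume_fiber_inter_closedBall_le {u : E} (hu : ‖u‖ = 1) {K : Set E} (hK : IsCompact K)
    {ρ : ℝ} (hρ : 0 ≤ ρ) {h : E} (hh : ⟪u, h⟫ = 0) :
    min (volume {s : ℝ | h + s • u ∈ K}) (volume {s : ℝ | h + s • u ∈ Metric.closedBall 0 ρ}) ≤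
      volume {s : ℝ | h + s • u ∈ fiberSymm u K ∩ Metric.closedBall 0 ρ} := by
  have hb : {s : ℝ | h + s • u ∈ Metric.closedBall 0 ρ} = {s : ℝ | ‖h‖ ^ 2 + s ^ 2 ≤ ρ ^ 2} := by
    ext s
    rw [Set.mem_ofPred_eq, Set.mem_ofPred_eq, mem_closedBall_zero_iff,
      ← pow_le_pow_iff_left₀ (norm_nonneg _) hρ two_ne_zero,
      norm_sq_add_smul_of_inner_eq_zero hu hh]
  have := min_volume_le_volume_inter_of_isCompact (isCompact_setOf_add_smul_mem hu hK h)
    (C' := {s : ℝ | h + s • u ∈ fiberSymm u K})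
    (fun a ha b hb s hs => mem_fiberSymm_of_abs_le hu hh ha hb hs) (‖h‖ ^ 2) (ρ ^ 2)
  rw [← hb] at this
  exact this

end FiberSymm

/-! ### Volume under symmetrization. -/

section Fubini

variable {E : Type*} [NormedAddCommGroup E] [InnerProductSpace ℝ E] [FiniteDimensional ℝ E]
  [MeasurableSpace E] [BorelSpace E]

/-- Fubini's theorem along the lines parallel to a unit vector, up to normalization. -/
theorem exists_volume_eq_lintegral_fiber {u : E} (hu : ‖u‖ = 1) :
    ∃ c : ℝ≥0∞, c ≠ 0 ∧ c ≠ ∞ ∧ ∀ A : Set E, MeasurableSet A →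
      Measurable (fun h : (ℝ ∙ u)ᗮ => volume {s : ℝ | (h : E) + s • u ∈ A}) ∧
      volume A = c * ∫⁻ h : (ℝ ∙ u)ᗮ, volume {s : ℝ | (h : E) + s • u ∈ A} := by
  let Ψ₀ : ((ℝ ∙ u)ᗮ × ℝ) →ₗ[ℝ] E :=
    LinearMap.coprod (Submodule.subtype _) (LinearMap.toSpanSingleton ℝ E u)
  have hΨ₀ : ∀ p, Ψ₀ p = (p.1 : E) + p.2 • u := fun p => rfl
  have huu : ⟪u, u⟫ = 1 := by rw [real_inner_self_eq_norm_sq, hu]; norm_num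
  have horth : ∀ h : (ℝ ∙ u)ᗮ, ⟪u, (h : E)⟫ = 0 := fun h =>
    Submodule.mem_orthogonal_singleton_iff_inner_right.1 h.2
  have hbij : Function.Bijective Ψ₀ := by
    constructor
    · rw [injective_iff_map_eq_zero]
      rintro ⟨h, s⟩ hs
      rw [hΨ₀] at hs
      have h1 : s = 0 := by
        have := congrArg (fun v => ⟪u, v⟫) hs
        simp only [inner_add_right, inner_smul_right, horth, huu, inner_zero_right] at this
        linarith
      subst h1
      simpa using hs
    · intro v
      refine ⟨(⟨v - ⟪u, v⟫ • u, ?_⟩, ⟪u, v⟫), by simp [hΨ₀]⟩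
      rw [Submodule.mem_orthogonal_singleton_iff_inner_right, inner_sub_right, inner_smul_right,
        huu]
      ring
  let Ψ : ((ℝ ∙ u)ᗮ × ℝ) ≃L[ℝ] E := (LinearEquiv.ofBijective Ψ₀ hbij).toContinuousLinearEquiv
  let μ : Measure ((ℝ ∙ u)ᗮ × ℝ) := (volume : Measure (ℝ ∙ u)ᗮ).prod volume
  -- Uniqueness of Haar measure gives proportionality; the constant only has to be nonzero and
  -- finite.
  have : (μ.map Ψ).IsAddHaarMeasure := Ψ.isAddHaarMeasure_map μ
  have hcμ := Measure.isAddLeftInvariant_eq_smul (volume : Measure E) (μ.map Ψ)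
  have hc0 := Measure.addHaarScalarFactor_pos_of_isAddHaarMeasure (volume : Measure E) (μ.map Ψ)
  refine ⟨_, ENNReal.coe_ne_zero.2 hc0.ne', ENNReal.coe_ne_top, fun A hA => ?_⟩
  have hA' : MeasurableSet (Ψ ⁻¹' A) := Ψ.continuous.measurable hA
  refine ⟨measurable_measure_prodMk_left hA', ?_⟩
  refine (DFunLike.congr_fun hcμ A).trans ?_
  rw [Measure.smul_apply, ENNReal.smul_def, smul_eq_mul,
    Measure.map_apply Ψ.continuous.measurable hA, Measure.prod_apply hA']
  rfl

theorem volume_inter_closedBall_le_fiberSymm {u : E} (hu : ‖u‖ = 1) {K : Set E}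
    (hK : IsCompact K) {ρ : ℝ} (hρ : 0 ≤ ρ) :
    volume (K ∩ Metric.closedBall 0 ρ) ≤ volume (fiberSymm u K ∩ Metric.closedBall 0 ρ) := by
  obtain ⟨c, -, -, hc⟩ := exists_volume_eq_lintegral_fiber hu
  have hm := Metric.isClosed_closedBall (x := (0 : E)) (ε := ρ) |>.measurableSet
  rw [(hc _ (hK.measurableSet.inter hm)).2, (hc _ ((hK.fiberSymm u).measurableSet.inter hm)).2]
  refine mul_le_mul_right (lintegral_mono fun h => ?_) c
  refine le_trans (le_min (measure_mono fun s hs => hs.1) (measure_mono fun s hs => hs.2))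
    (volume_fiber_inter_closedBall_le hu hK hρ
      (Submodule.mem_orthogonal_singleton_iff_inner_right.1 h.2))

theorem volume_le_fiberSymm {u : E} (hu : ‖u‖ = 1) {K : Set E} (hK : IsCompact K) :
    volume K ≤ volume (fiberSymm u K) := by
  obtain ⟨R, hR⟩ := (Metric.isBounded_iff_subset_closedBall 0).1 hK.isBounded
  have := volume_inter_closedBall_le_fiberSymm hu hK (le_max_right R 0)
  rw [Set.inter_eq_left.2 (hR.trans (Metric.closedBall_subset_closedBall (le_max_left R 0)))] at this
  exact this.trans (measure_mono Set.inter_subset_left)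

/-- A compact set that is at least as large as a centred ball, but does not fill it, fills more of
it after a suitable symmetrization. -/
theorem exists_volume_inter_closedBall_lt_fiberSymm [Nontrivial E] {K : Set E} (hK : IsCompact K)
    {ρ : ℝ} (hρ : 0 ≤ ρ) (hle : volume (Metric.closedBall (0 : E) ρ) ≤ volume K)
    (hlt : volume (K ∩ Metric.closedBall 0 ρ) < volume (Metric.closedBall (0 : E) ρ)) :
    ∃ u : E, ‖u‖ = 1 ∧
      volume (K ∩ Metric.closedBall 0 ρ) < volume (fiberSymm u K ∩ Metric.closedBall 0 ρ) := by
  set B := Metric.closedBall (0 : E) ρ with hB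
  have hBm : MeasurableSet B := Metric.isClosed_closedBall.measurableSet
  obtain ⟨p, hp⟩ : (Metric.ball (0 : E) ρ \ K).Nonempty := by
    by_contra hne
    rw [Set.not_nonempty_iff_eq_empty, Set.sdiff_eq_empty] at hne
    refine hlt.not_ge ?_
    rw [hB, Measure.addHaar_closedBall_eq_addHaar_ball]
    exact measure_mono fun x hx => ⟨hne hx, Metric.ball_subset_closedBall hx⟩
  obtain ⟨ε₁, hε₁, hp1⟩ := Metric.isOpen_iff.1 (Metric.isOpen_ball.sdiff hK.isClosed) p hp
  have hKB : volume (K \ B) ≠ 0 := by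
    intro h0
    have := measure_inter_add_sdiff (μ := volume) K hBm
    rw [h0, add_zero] at this
    exact (hlt.trans_le hle).ne this
  obtain ⟨q, hq, hqpos⟩ := exists_mem_forall_mem_nhdsWithin_pos_measure hKB
  obtain ⟨ε₂, hε₂, hq2⟩ := Metric.isOpen_iff.1 Metric.isClosed_closedBall.isOpen_compl q hq.2
  set ε := min ε₁ ε₂ with hε
  have hεpos : 0 < ε := lt_min hε₁ hε₂
  have hpq : q - p ≠ 0 := by
    intro h0
    rw [sub_eq_zero] at h0
    exact hq.2 (h0 ▸ Metric.ball_subset_closedBall hp.1)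
  have hpq' : ‖q - p‖ ≠ 0 := norm_ne_zero_iff.2 hpq
  -- `p` lies in a hole of `K` inside the ball and `q` is a point of `K` outside the ball near which
  -- `K \ B` has positive measure. Lines parallel to `p - q` that meet `K \ B` near `q` also cross
  -- the hole near `p`.
  set u := ‖q - p‖⁻¹ • (q - p) with hu_def
  have hu : ‖u‖ = 1 := by rw [hu_def, norm_smul, norm_inv, norm_norm, inv_mul_cancel₀ hpq']
  have hqp : p = q - ‖q - p‖ • u := by
    rw [hu_def, smul_smul, mul_inv_cancel₀ hpq', one_smul]; abel
  refine ⟨u, hu, ?_⟩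
  obtain ⟨c, hc0, hctop, hc⟩ := exists_volume_eq_lintegral_fiber hu
  have hN : MeasurableSet (Metric.ball q ε ∩ (K \ B)) :=
    Metric.isOpen_ball.measurableSet.inter (hK.measurableSet.diff hBm)
  have hNpos : volume (Metric.ball q ε ∩ (K \ B)) ≠ 0 :=
    (hqpos _ (by
      rw [Set.inter_comm]
      exact inter_mem_nhdsWithin _ (Metric.ball_mem_nhds q hεpos))).ne'
  obtain ⟨hNm, hNeq⟩ := hc _ hN
  obtain ⟨hm1, heq1⟩ := hc _ (hK.measurableSet.inter hBm)
  obtain ⟨hm2, heq2⟩ := hc _ ((hK.fiberSymm u).measurableSet.inter hBm)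
  have hfin : volume (K ∩ B) ≠ ∞ :=
    ((measure_mono Set.inter_subset_left).trans_lt hK.measure_lt_top).ne
  rw [heq1] at hfin
  rw [heq1, heq2]
  refine ENNReal.mul_lt_mul_right hc0 hctop ?_
  have horth : ∀ h : (ℝ ∙ u)ᗮ, ⟪u, (h : E)⟫ = 0 := fun h =>
    Submodule.mem_orthogonal_singleton_iff_inner_right.1 h.2
  -- On these lines the fibers of `K` and of `B` both exceed that of `K ∩ B` in measure, so the
  -- fiberwise inequality is strict; they form a set of positive measure.
  refine lintegral_strict_mono_of_ae_le_of_ae_lt_on hm2.aemeasurable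
    (fun h0 => hfin (by rw [h0, ENNReal.mul_top hc0])) (ae_of_all _ fun h => ?_)
    (s := {h : (ℝ ∙ u)ᗮ | volume {s : ℝ | (h : E) + s • u ∈ Metric.ball q ε ∩ (K \ B)} ≠ 0})
    ?_ (ae_of_all _ fun h hs => ?_)
  · exact le_trans (le_min (measure_mono fun s hs => hs.1) (measure_mono fun s hs => hs.2))
      (volume_fiber_inter_closedBall_le hu hK hρ (horth h))
  · intro h0
    refine hNpos ?_
    rw [hNeq, (lintegral_eq_zero_iff hNm).2, mul_zero]
    exact measure_mono_null (fun h hh => hh) h0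
  · refine lt_of_lt_of_le ?_ (volume_fiber_inter_closedBall_le hu hK hρ (horth h))
    have hcont : Continuous fun s : ℝ => (h : E) + s • u := by fun_prop
    have hF : MeasurableSet {s : ℝ | (h : E) + s • u ∈ K} := hcont.measurable hK.measurableSet
    have hG : MeasurableSet {s : ℝ | (h : E) + s • u ∈ B} := hcont.measurable hBm
    have hfin' : volume ({s : ℝ | (h : E) + s • u ∈ K} ∩ {s : ℝ | (h : E) + s • u ∈ B}) ≠ ∞ :=
      ((measure_mono Set.inter_subset_left).trans_lt
        (isCompact_setOf_add_smul_mem hu hK (h : E)).measure_lt_top).ne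
    change volume ({s : ℝ | (h : E) + s • u ∈ K} ∩ {s : ℝ | (h : E) + s • u ∈ B}) < _
    refine lt_min ?_ ?_
    · rw [← measure_inter_add_sdiff (μ := volume) {s : ℝ | (h : E) + s • u ∈ K} hG]
      refine ENNReal.lt_add_right hfin' fun h0 => hs (measure_mono_null ?_ h0)
      exact fun s hs => hs.2
    · rw [← measure_inter_add_sdiff (μ := volume) {s : ℝ | (h : E) + s • u ∈ B} hF,
        Set.inter_comm {s : ℝ | (h : E) + s • u ∈ B}]
      refine ENNReal.lt_add_right hfin' fun h0 => ?_
      obtain ⟨t, ht⟩ := nonempty_of_measure_ne_zero hs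
      have hopen : IsOpen {s : ℝ | (h : E) + s • u ∈ Metric.ball p ε₁} :=
        Metric.isOpen_ball.preimage hcont
      refine (hopen.measure_pos volume ⟨t - ‖q - p‖, ?_⟩).ne' (measure_mono_null ?_ h0)
      · have ht1 : dist ((h : E) + t • u) q < ε₁ :=
          (Metric.mem_ball.1 ht.1).trans_le (min_le_left _ _)
        rw [Set.mem_ofPred_eq, Metric.mem_ball, dist_eq_norm] at *
        convert! ht1 using 2
        nth_rw 2 [hqp]
        rw [sub_smul]; abel
      · exact fun s hs => ⟨Metric.ball_subset_closedBall (hp1 hs).1, (hp1 hs).2⟩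

end Fubini

/-! ### Maximizing over compact sets. -/

section Compactness

/-- Take an open `U ⊇ K ∩ F` of measure below `r`; then `L ⊆ U ∪ Fᶜ` is an open condition on `L`. -/
theorem TopologicalSpace.Compacts.upperSemicontinuous_measure_inter {X : Type*}
    [TopologicalSpace X] [MeasurableSpace X] (μ : Measure X) [μ.OuterRegular]
    {F : Set X} (hF : IsClosed F) :
    UpperSemicontinuous fun K : TopologicalSpace.Compacts X => μ (K ∩ F) := by
  intro K r hr
  obtain ⟨U, hKU, hU, hUr⟩ := Set.exists_isOpen_lt_of_lt _ r hr
  have hV : IsOpen {L : TopologicalSpace.Compacts X | (L : Set X) ⊆ U ∪ Fᶜ} :=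
    TopologicalSpace.Compacts.isOpen_subsets_of_isOpen (hU.union hF.isOpen_compl)
  have hK : (K : Set X) ⊆ U ∪ Fᶜ := fun x hx => by
    by_cases hxF : x ∈ F
    exacts [.inl (hKU ⟨hx, hxF⟩), .inr hxF]
  filter_upwards [hV.mem_nhds hK] with L hL
  refine (measure_mono fun x hx => ?_).trans_lt hUr
  exact (hL hx.1).resolve_right fun h => h hx.2

theorem TopologicalSpace.Compacts.isClosed_setOf_forall_pi_mem {ι X : Type*} [Finite ι]
    [TopologicalSpace X] {F : Set (ι → X)} (hF : IsClosed F) :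
    IsClosed {L : ι → TopologicalSpace.Compacts X | ∀ z, (∀ j, z j ∈ L j) → z ∈ F} := by
  rw [← isOpen_compl_iff, isOpen_iff_mem_nhds]
  intro L hL
  simp only [Set.mem_compl_iff, Set.mem_ofPred_eq, not_forall] at hL
  obtain ⟨z, hzL, hz⟩ := hL
  obtain ⟨U, hU, hUF⟩ := isOpen_pi_iff'.1 hF.isOpen_compl z hz
  have hopen : IsOpen (Set.pi Set.univ fun j =>
      {M : TopologicalSpace.Compacts X | ((M : Set X) ∩ U j).Nonempty}) :=
    isOpen_set_pi Set.finite_univ fun j _ =>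
      TopologicalSpace.Compacts.isOpen_inter_nonempty_of_isOpen (hU j).1
  filter_upwards [hopen.mem_nhds fun j _ => ⟨z j, hzL j, (hU j).2⟩] with M hM hMF
  choose w hw using fun j => hM j trivial
  exact hUF (fun j _ => (hw j).2) (hMF w fun j => (hw j).1)

variable {E : Type*} [NormedAddCommGroup E] [InnerProductSpace ℝ E] [FiniteDimensional ℝ E]
  [MeasurableSpace E] [BorelSpace E] [Nontrivial E]

/-- The rearrangement inequality for compact sets: a bound for a fiber-linear function on a product
of compact sets persists on the product of the centred balls that are not larger. -/
theorem IsFiberLinear.abs_le_of_mem_ball {ι : Type*} [Fintype ι] {P : (ι → E) → ℝ}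
    (hP : IsFiberLinear P) (hPc : Continuous P) {K : ι → Set E} (hK : ∀ j, IsCompact (K j))
    {ρ : ι → ℝ} (hρ : ∀ j, 0 ≤ ρ j)
    (hle : ∀ j, volume (Metric.closedBall (0 : E) (ρ j)) ≤ volume (K j)) {M : ℝ}
    (hM : ∀ z, (∀ j, z j ∈ K j) → |P z| ≤ M) {z : ι → E}
    (hz : ∀ j, z j ∈ Metric.ball 0 (ρ j)) : |P z| ≤ M := by
  classical
  obtain ⟨R, hR⟩ := (Metric.isBounded_iff_subset_closedBall 0).1
    (isCompact_iUnion hK).isBounded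
  rw [Set.iUnion_subset_iff] at hR
  let X : Set (ι → TopologicalSpace.Compacts E) :=
    Set.pi Set.univ fun _ => {L | (L : Set E) ⊆ Metric.closedBall 0 R}
  let Y : Set (ι → TopologicalSpace.Compacts E) :=
    {L | ∀ j, volume (Metric.closedBall (0 : E) (ρ j)) ≤ volume (L j : Set E)}
  let Z : Set (ι → TopologicalSpace.Compacts E) := {L | ∀ z, (∀ j, z j ∈ L j) → z ∈ {z | |P z| ≤ M}}
  let Φ : (ι → TopologicalSpace.Compacts E) → ℝ≥0∞ :=
    fun L => ∑ j, volume ((L j : Set E) ∩ Metric.closedBall 0 (ρ j))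
  have husc : ∀ (F : Set E), IsClosed F → ∀ j, UpperSemicontinuous
      fun L : ι → TopologicalSpace.Compacts E => volume ((L j : Set E) ∩ F) := fun F hF j =>
    (TopologicalSpace.Compacts.upperSemicontinuous_measure_inter volume hF).comp
      (continuous_apply j)
  have hX : IsCompact X := isCompact_univ_pi fun _ =>
    TopologicalSpace.Compacts.isCompact_subsets_of_isCompact (isCompact_closedBall 0 R)
  have hY : IsClosed Y := by
    simp only [Y, Set.ofPred_forall]
    refine isClosed_iInter fun j => ?_
    have := (husc Set.univ isClosed_univ j).isClosed_preimage
      (volume (Metric.closedBall (0 : E) (ρ j)))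
    simp only [Set.inter_univ] at this
    exact this
  have hZ : IsClosed Z := TopologicalSpace.Compacts.isClosed_setOf_forall_pi_mem
    (isClosed_le hPc.abs continuous_const)
  have hΦ : UpperSemicontinuous Φ :=
    upperSemicontinuous_sum fun j _ => husc _ Metric.isClosed_closedBall j
  obtain ⟨L, ⟨⟨hLX, hLY⟩, hLZ⟩, hmax⟩ := (hΦ.upperSemicontinuousOn _).exists_isMaxOn
    (s := X ∩ Y ∩ Z) ⟨fun j => ⟨K j, hK j⟩, ⟨fun j _ => hR j, hle⟩, hM⟩
    ((hX.inter_right hY).inter_right hZ)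
  have hfill : ∀ j, volume (Metric.closedBall (0 : E) (ρ j)) ≤
      volume ((L j : Set E) ∩ Metric.closedBall 0 (ρ j)) := by
    by_contra! hcon
    obtain ⟨j, hj⟩ := hcon
    obtain ⟨u, hu, hlt⟩ := exists_volume_inter_closedBall_lt_fiberSymm (L j).isCompact (hρ j)
      (hLY j) hj
    -- All sets are symmetrized along the same `u`, as the bound on `P` requires; no term of `Φ`
    -- decreases and the `j`-th increases.
    let L' : ι → TopologicalSpace.Compacts E :=
      fun i => ⟨fiberSymm u (L i), (L i).isCompact.fiberSymm u⟩
    have hL' : L' ∈ X ∩ Y ∩ Z := by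
      refine ⟨⟨fun i _ => fiberSymm_subset_closedBall hu (hLX i trivial), fun i => ?_⟩, fun z hz => ?_⟩
      · exact (hLY i).trans (volume_le_fiberSymm hu (L i).isCompact)
      · exact hP.abs_le_of_mem_fiberSymm hu hLZ hz
    have hle' : Φ L' ≤ Φ L := hmax hL'
    refine hle'.not_gt ?_
    simp only [Φ]
    rw [← Finset.add_sum_erase _ _ (Finset.mem_univ j),
      ← Finset.add_sum_erase (a := j) Finset.univ _ (Finset.mem_univ j)]
    refine ENNReal.add_lt_add_of_lt_of_le ?_ hlt (Finset.sum_le_sum fun i _ =>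
      volume_inter_closedBall_le_fiberSymm hu (L i).isCompact (hρ i))
    exact (ENNReal.sum_lt_top.2 fun i _ => (measure_mono Set.inter_subset_left).trans_lt
      (L i).isCompact.measure_lt_top).ne
  -- `L j` fills its ball up to a null set and is closed, so it contains the open ball.
  refine hLZ z fun j => ?_
  by_contra hzj
  have hopen : IsOpen (Metric.ball (0 : E) (ρ j) \ L j) :=
    Metric.isOpen_ball.sdiff (L j).isCompact.isClosed
  have hpos := (hopen.measure_pos volume ⟨z j, hz j, hzj⟩).ne'
  refine hpos (measure_mono_null (t := Metric.closedBall (0 : E) (ρ j) \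
    ((L j : Set E) ∩ Metric.closedBall 0 (ρ j))) ?_ ?_)
  · exact fun x hx => ⟨Metric.ball_subset_closedBall hx.1, fun h => hx.2 h.1⟩
  · rw [measure_sdiff Set.inter_subset_right
      ((L j).isCompact.inter_right Metric.isClosed_closedBall).measurableSet.nullMeasurableSet,
      tsub_eq_zero_of_le (hfill j)]
    exact ((measure_mono Set.inter_subset_right).trans_lt measure_closedBall_lt_top).ne

end Compactness

/-! ### From compact to measurable sets. -/

section Measurable

theorem MeasureTheory.Measure.addHaar_closedBall_lt_ball {E : Type*} [NormedAddCommGroup E]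
    [NormedSpace ℝ E] [FiniteDimensional ℝ E] [MeasurableSpace E] [BorelSpace E] [Nontrivial E]
    (μ : Measure E) [μ.IsAddHaarMeasure] {r s : ℝ} (hr : 0 ≤ r) (hrs : r < s) :
    μ (Metric.closedBall 0 r) < μ (Metric.ball 0 s) := by
  rw [Measure.addHaar_closedBall _ _ hr, Measure.addHaar_ball _ _ (hr.trans hrs.le)]
  refine ENNReal.mul_lt_mul_left (Metric.measure_ball_pos μ _ one_pos).ne'
    measure_ball_lt_top.ne ?_
  exact (ENNReal.ofReal_lt_ofReal_iff (pow_pos (hr.trans_lt hrs) _)).2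
    (pow_lt_pow_left₀ hrs hr Module.finrank_pos.ne')

variable {E : Type*} [NormedAddCommGroup E] [InnerProductSpace ℝ E] [FiniteDimensional ℝ E]
  [MeasurableSpace E] [BorelSpace E]

/-- Every set of measure greater than `r` contains a compact set of measure greater than `r` all of
whose relatively open nonempty subsets have positive measure. -/
theorem MeasureTheory.NullMeasurableSet.exists_isCompact_inter_pos {A : Set E}
    (hA : NullMeasurableSet A) {r : ℝ≥0∞} (hr : r < volume A) :
    ∃ K ⊆ A, IsCompact K ∧ r < volume K ∧
      ∀ x ∈ K, ∀ U, IsOpen U → x ∈ U → volume (U ∩ K) ≠ 0 := by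
  obtain ⟨A', hA'A, hA', hAe⟩ := hA.exists_measurable_subset_ae_eq
  rw [← measure_congr hAe] at hr
  obtain ⟨K, hKA, hK, hrK⟩ := hA'.exists_lt_isCompact hr
  -- Passing to the support of `ν` removes only a null set from `K`.
  set ν := volume.restrict K with hν
  have hS : MeasurableSet ν.support := Measure.isClosed_support.measurableSet
  have hnull : volume (K \ ν.support) = 0 := by
    have := Measure.measure_compl_support (μ := ν)
    rwa [hν, Measure.restrict_apply hS.compl, Set.inter_comm] at this
  refine ⟨K ∩ ν.support, fun x hx => hA'A (hKA hx.1), hK.inter_right Measure.isClosed_support,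
    ?_, fun x hx U hU hxU h0 => ?_⟩
  · have := measure_inter_add_sdiff (μ := volume) K hS
    rw [hnull, add_zero] at this
    rwa [this]
  · have h1 : 0 < ν U := (Measure.mem_support_iff_forall x).1 hx.2 U (hU.mem_nhds hxU)
    rw [hν, Measure.restrict_apply hU.measurableSet] at h1
    refine h1.ne' (measure_mono_null (t := (U ∩ (K ∩ ν.support)) ∪ (K \ ν.support)) ?_
      (measure_union_null h0 hnull))
    intro y hy
    by_cases hyS : y ∈ ν.support
    exacts [.inl ⟨hy.1, hy.2, hyS⟩, .inr ⟨hy.2, hyS⟩]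

/-- A violation of the bound at a point of `∏ K j` persists on an open box around it, which meets `∏
K j` in positive measure. Radii strictly between `‖z j‖` and `r j` leave room for inner
approximation. -/
theorem IsFiberLinear.abs_le_of_ae_abs_le [Nontrivial E] {ι : Type*} [Fintype ι]
    {P : (ι → E) → ℝ} (hP : IsFiberLinear P) (hPc : Continuous P) {A : ι → Set E}
    (hA : ∀ j, NullMeasurableSet (A j)) {r : ι → ℝ}
    (hle : ∀ j, volume (Metric.ball (0 : E) (r j)) ≤ volume (A j)) {M : ℝ}
    (hM : ∀ᵐ y : ι → E, (∀ j, y j ∈ A j) → |P y| ≤ M) {z : ι → E}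
    (hz : ∀ j, z j ∈ Metric.ball 0 (r j)) : |P z| ≤ M := by
  have hzr : ∀ j, ‖z j‖ < r j := fun j => mem_ball_zero_iff.1 (hz j)
  have hρ : ∀ j, 0 ≤ (‖z j‖ + r j) / 2 := fun j => by
    linarith [norm_nonneg (z j), hzr j]
  choose K hKA hK hKr hKpos using fun j => (hA j).exists_isCompact_inter_pos
    ((Measure.addHaar_closedBall_lt_ball volume (hρ j) (by linarith [hzr j])).trans_le (hle j))
  refine hP.abs_le_of_mem_ball hPc hK hρ (fun j => (hKr j).le) (fun y hy => ?_)
    fun j => mem_ball_zero_iff.2 (by linarith [hzr j])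
  by_contra hcon
  obtain ⟨U, hU, hUP⟩ := isOpen_pi_iff'.1 (isOpen_lt continuous_const hPc.abs) y (not_le.1 hcon)
  have h0 : volume (Set.pi Set.univ fun j => U j ∩ K j) = 0 := by
    refine measure_mono_null (fun w hw => ?_) hM
    intro h
    exact (hUP fun j _ => (hw j trivial).1).not_ge (h fun j => hKA j (hw j trivial).2)
  rw [volume_pi_pi, Finset.prod_eq_zero_iff] at h0
  obtain ⟨j, -, hj⟩ := h0
  exact hKpos j (y j) (hy j) (U j) (hU j).1 (hU j).2 hj

end Measurable

/-! ### From sets to functions. -/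

section Functions

theorem ENNReal.prod_mul_le_of_forall_lt {ι : Type*} (s : Finset ι) {a : ι → ℝ≥0∞}
    {p S : ℝ≥0∞}
    (h : ∀ τ : ι → ℝ≥0∞, (∀ j ∈ s, τ j < a j) → (∏ j ∈ s, τ j) * p ≤ S) :
    (∏ j ∈ s, a j) * p ≤ S := by
  classical
  induction s using Finset.induction_on generalizing p with
  | empty => simpa using h 0
  | insert i s hi ih =>
    rw [Finset.prod_insert hi, mul_assoc]
    refine ENNReal.mul_le_of_forall_lt fun x hx y hy => ?_
    refine (mul_le_mul_right hy.le x).trans ?_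
    rw [mul_left_comm]
    refine ih fun τ hτ => ?_
    have := h (Function.update τ i x) fun j hj => ?_
    · rw [Finset.prod_insert hi, Function.update_self, Finset.prod_congr rfl fun j hj =>
        Function.update_of_ne (ne_of_mem_of_not_mem hj hi) x τ] at this
      rwa [mul_left_comm, ← mul_assoc]
    · rcases Finset.mem_insert.1 hj with rfl | hj'
      · simpa using hx
      · rw [Function.update_of_ne (ne_of_mem_of_not_mem hj' hi)]
        exact hτ j hj'

variable {n : ℕ}

/-- Otherwise the integrand defining the rearrangement vanishes for `t > τ`, so the integral is at
most `τ`. -/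
theorem exists_mem_symmRearrSet_of_lt_symmDecrRearr {f : EuclideanSpace ℝ (Fin n) → ℝ≥0∞}
    {x : EuclideanSpace ℝ (Fin n)} {τ : ℝ≥0∞} (h : τ < symmDecrRearr f x) :
    ∃ t : ℝ, 0 < t ∧ τ < ENNReal.ofReal t ∧ x ∈ symmRearrSet {y | ENNReal.ofReal t < f y} := by
  by_contra! hcon
  refine h.not_ge ?_
  calc symmDecrRearr f x
      ≤ ∫⁻ t in Set.Ioi (0 : ℝ), (Set.Iic τ.toReal).indicator (fun _ => 1) t := by
        refine setLIntegral_mono' measurableSet_Ioi fun t ht => ?_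
        by_cases hx : x ∈ symmRearrSet {y | ENNReal.ofReal t < f y}
        · have h1 : t ≤ τ.toReal := by
            by_contra! hlt
            exact hcon t ht ((ENNReal.lt_ofReal_iff_toReal_lt h.ne_top).2 hlt) hx
          rw [Set.indicator_of_mem (show t ∈ Set.Iic _ from h1)]
          exact Set.indicator_le_self' (by simp) _
        · rw [Set.indicator_of_notMem hx]
          exact zero_le
    _ = volume (Set.Ioc 0 τ.toReal) := by
        rw [lintegral_indicator measurableSet_Iic, setLIntegral_one,
          Measure.restrict_apply measurableSet_Iic, Set.inter_comm, Set.Ioi_inter_Iic]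
    _ = τ := by rw [Real.volume_Ioc, sub_zero, ENNReal.ofReal_toReal h.ne_top]

/-- The functional rearrangement inequality for fiber-linear functions. -/
theorem IsFiberLinear.prod_symmDecrRearr_mul_le (hn : 1 ≤ n) {ι : Type*} [Fintype ι]
    {P : (ι → EuclideanSpace ℝ (Fin n)) → ℝ} (hP : IsFiberLinear P) (hPc : Continuous P)
    {f : ι → EuclideanSpace ℝ (Fin n) → ℝ≥0∞} (hf : ∀ j, AEMeasurable (f j) volume)
    (hfv : ∀ j, VanishesAtInfinity (f j)) {S : ℝ≥0∞}
    (hS : ∀ᵐ y : ι → EuclideanSpace ℝ (Fin n), (∏ j, f j (y j)) * ENNReal.ofReal |P y| ≤ S)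
    (z : ι → EuclideanSpace ℝ (Fin n)) :
    (∏ j, symmDecrRearr (f j) (z j)) * ENNReal.ofReal |P z| ≤ S := by
  have : Nonempty (Fin n) := ⟨⟨0, hn⟩⟩
  rcases eq_or_ne S ∞ with rfl | hS'
  · exact le_top
  refine ENNReal.prod_mul_le_of_forall_lt _ fun τ hτ => ?_
  choose t ht0 htτ htz using fun j =>
    exists_mem_symmRearrSet_of_lt_symmDecrRearr (hτ j (Finset.mem_univ j))
  have hT : 0 < ∏ j, t j := Finset.prod_pos fun j _ => ht0 j
  have hiff : ∀ y, (∏ j, ENNReal.ofReal (t j)) * ENNReal.ofReal |P y| ≤ S ↔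
      |P y| ≤ S.toReal / ∏ j, t j := fun y => by
    rw [← ENNReal.ofReal_prod_of_nonneg fun j _ => (ht0 j).le, ← ENNReal.ofReal_mul hT.le,
      ENNReal.ofReal_le_iff_le_toReal hS', le_div_iff₀' hT]
  calc (∏ j, τ j) * ENNReal.ofReal |P z|
      ≤ (∏ j, ENNReal.ofReal (t j)) * ENNReal.ofReal |P z| := by
        gcongr with j; exact (htτ j).le
    _ ≤ S := (hiff z).2 ?_
  refine hP.abs_le_of_ae_abs_le hPc (A := fun j => {y | ENNReal.ofReal (t j) < f j y})
    (fun j => nullMeasurableSet_lt aemeasurable_const (hf j))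
    (fun j => (volume_symmRearrSet hn _ (hfv j (t j) (ht0 j))).le) ?_ htz
  filter_upwards [hS] with y hy hyA
  refine (hiff y).1 (le_trans ?_ hy)
  gcongr with j
  exact (hyA j).le

end Functions

/-! ### The determinant as a fiber-linear function. -/

section Simplex

theorem IsFiberLinear.const_mul {E : Type*} [NormedAddCommGroup E] [InnerProductSpace ℝ E]
    {ι : Type*} [Fintype ι] {P : (ι → E) → ℝ} (hP : IsFiberLinear P) (k : ℝ) :
    IsFiberLinear fun z => k * P z := by
  intro u hu x hx
  obtain ⟨c, hc⟩ := hP u hu x hx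
  refine ⟨fun j => k * c j, fun s => ?_⟩
  simp only [hc, Finset.mul_sum, mul_assoc]

/-- Linear combinations of the points act separately on the components orthogonal to `u` and on the
heights. -/
theorem IsFiberLinear.comp_sum_smul {E : Type*} [NormedAddCommGroup E] [InnerProductSpace ℝ E]
    {ι κ : Type*} [Fintype ι] [Fintype κ] {P : (κ → E) → ℝ} (hP : IsFiberLinear P)
    (B : Matrix κ ι ℝ) : IsFiberLinear fun z : ι → E => P fun k => ∑ i, B k i • z i := by
  intro u hu x hx
  obtain ⟨c, hc⟩ := hP u hu (fun k => ∑ i, B k i • x i) fun k => by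
    simp [inner_sum, inner_smul_right, hx]
  refine ⟨fun i => ∑ k, c k * B k i, fun s => ?_⟩
  have : (fun k => ∑ i, B k i • (x i + s i • u)) =
      fun k => ∑ i, B k i • x i + (∑ i, B k i * s i) • u := by
    ext1 k
    simp only [smul_add, Finset.sum_add_distrib, Finset.sum_smul, smul_smul]
  have h := hc fun k => ∑ i, B k i * s i
  rw [← this] at h
  refine h.trans ?_
  simp only [Finset.mul_sum, Finset.sum_mul]
  rw [Finset.sum_comm]
  simp only [mul_assoc]

variable {n : ℕ}

/-- The matrix of the edges of a simplex that start at its first vertex. -/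
def edgeMatrix (y : Fin (n + 1) → EuclideanSpace ℝ (Fin n)) : Matrix (Fin n) (Fin n) ℝ :=
  Matrix.of fun i j => y j.succ i - y 0 i

theorem continuous_det_edgeMatrix :
    Continuous fun y : Fin (n + 1) → EuclideanSpace ℝ (Fin n) => (edgeMatrix y).det := by
  refine Continuous.matrix_det (continuous_matrix fun i j => ?_)
  simp only [edgeMatrix, Matrix.of_apply]
  fun_prop

theorem isFiberLinear_det_edgeMatrix :
    IsFiberLinear fun y : Fin (n + 1) → EuclideanSpace ℝ (Fin n) => (edgeMatrix y).det := by
  intro u hu x hx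
  have huu : ∑ i, u i * u i = 1 := by
    have := EuclideanSpace.real_norm_sq_eq u
    rw [hu] at this
    simpa [sq] using this.symm
  have hxu : ∀ j, ∑ i, u i * x j i = 0 := fun j => by
    have := hx j
    rw [PiLp.inner_apply] at this
    simpa [mul_comm] using this
  obtain ⟨k, hk⟩ : ∃ k, u k ≠ 0 := by
    by_contra! h
    simp [h] at huu
  -- Row `k` of `T` reads off the height along `u`; the other rows are those of the projection onto
  -- `uᗮ`. Hence only row `k` of `T * edgeMatrix` involves the heights, and `u k ≠ 0` makes `T`
  -- invertible.
  let T : Matrix (Fin n) (Fin n) ℝ :=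
    Matrix.updateRow (Matrix.of fun i j => (1 : Matrix (Fin n) (Fin n) ℝ) i j - u i * u j) k u
  have hTk : ∀ v : Fin n → ℝ, T.mulVec v k = ∑ j, u j * v j := fun v => by
    simp [T, Matrix.mulVec, dotProduct]
  have hTi : ∀ v : Fin n → ℝ, ∀ i ≠ k, T.mulVec v i = v i - u i * ∑ j, u j * v j := fun v i hi => by
    simp only [T, Matrix.mulVec, dotProduct, Matrix.updateRow_ne hi, Matrix.of_apply, sub_mul,
      Finset.sum_sub_distrib, Finset.mul_sum, mul_assoc]
    simp [Matrix.one_apply]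
  have hT : T.det ≠ 0 := by
    intro h0
    obtain ⟨v, hv0, hv⟩ := Matrix.exists_mulVec_eq_zero_iff.2 h0
    have h1 : ∑ j, u j * v j = 0 := by rw [← hTk, hv]; rfl
    have h2 : ∀ i ≠ k, v i = 0 := fun i hi => by
      have := hTi v i hi
      rw [hv, h1, mul_zero, sub_zero] at this
      exact this.symm
    refine hv0 (funext fun i => ?_)
    by_cases hi : i = k
    · subst hi
      rw [Finset.sum_eq_single i (fun j _ hj => by rw [h2 j hj, mul_zero]) (by simp)] at h1
      exact (mul_eq_zero.1 h1).resolve_left hk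
    · exact h2 i hi
  let σ : (Fin (n + 1) → ℝ) →ₗ[ℝ] (Fin n → ℝ) :=
    LinearMap.pi fun j : Fin n =>
      (LinearMap.proj (R := ℝ) (φ := fun _ => ℝ) j.succ - LinearMap.proj 0 : (Fin (n + 1) → ℝ) →ₗ[ℝ] ℝ)
  have hσ : ∀ s j, σ s j = s j.succ - s 0 := fun s j => rfl
  let ψ : (Fin (n + 1) → ℝ) →ₗ[ℝ] ℝ :=
    T.det⁻¹ • (LinearMap.proj k ∘ₗ Matrix.cramer (edgeMatrix x).transpose ∘ₗ σ)
  refine ⟨fun j => ψ (Pi.single j 1), fun s => ?_⟩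
  have hmul : T * edgeMatrix (fun j => x j + s j • u) = (edgeMatrix x).updateRow k (σ s) := by
    ext i j
    have hsum : ∑ l, u l * edgeMatrix (fun j => x j + s j • u) l j = σ s j := by
      have : ∀ l, u l * edgeMatrix (fun j => x j + s j • u) l j =
          u l * x j.succ l - u l * x 0 l + (s j.succ - s 0) * (u l * u l) := fun l => by
        simp [edgeMatrix]; ring
      simp only [this, Finset.sum_add_distrib, Finset.sum_sub_distrib, hxu, ← Finset.mul_sum, huu,
        hσ]
      ring
    change T.mulVec (fun l => edgeMatrix (fun j => x j + s j • u) l j) i = _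
    by_cases hi : i = k
    · subst hi
      rw [hTk, hsum, Matrix.updateRow_self]
    · rw [hTi _ i hi, hsum, Matrix.updateRow_ne hi, hσ]
      simp [edgeMatrix]; ring
  have hdet : (edgeMatrix fun j => x j + s j • u).det = ψ s := by
    have := congrArg Matrix.det hmul
    rw [Matrix.det_mul] at this
    change _ = T.det⁻¹ * Matrix.cramer (edgeMatrix x).transpose (σ s) k
    rw [Matrix.cramer_transpose_apply, ← this, inv_mul_cancel_left₀ hT]
  change (edgeMatrix fun j => x j + s j • u).det = _
  rw [hdet, LinearMap.pi_apply_eq_sum_univ ψ s]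
  refine Finset.sum_congr rfl fun j _ => ?_
  rw [smul_eq_mul, mul_comm]
  congr 2
  ext i
  simp [Pi.single_apply, eq_comm]

/-- The determinant of a simplex is, up to a constant, the absolute value of the determinant of its
edge matrix. -/
theorem exists_simplexDet_eq (n : ℕ) :
    ∃ c : ℝ, ∀ y : Fin (n + 1) → EuclideanSpace ℝ (Fin n),
      simplexDet y = ENNReal.ofReal |c * (edgeMatrix y).det| := by
  let b := (EuclideanSpace.basisFun (Fin n) ℝ).toBasis
  -- Every simplex is an affine image of the standard one, with the edge matrix as linear part. The
  -- constant is the determinant of the standard simplex; its value is not needed.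
  let v : Fin (n + 1) → EuclideanSpace ℝ (Fin n) := Fin.cons 0 b
  have hfin : volume (convexHull ℝ (Set.range v)) ≠ ∞ :=
    ((Set.finite_range v).isCompact_convexHull (𝕜 := ℝ)).measure_lt_top.ne
  refine ⟨((n.factorial : ℝ≥0∞) * volume (convexHull ℝ (Set.range v))).toReal, fun y => ?_⟩
  let L := Matrix.toLin b b (edgeMatrix y)
  have hL : ∀ i, y i = y 0 + L (v i) := by
    intro i
    refine Fin.cases (by simp [v]) (fun j => ?_) i
    simp only [v, Fin.cons_succ, L, Matrix.toLin_self]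
    ext l
    simp [b, edgeMatrix, Pi.single_apply]
  have hrange : Set.range y = (fun p => y 0 + p) '' (L '' Set.range v) := by
    rw [← Set.range_comp, ← Set.range_comp]
    exact congrArg Set.range (funext hL)
  have himage : convexHull ℝ ((fun p => y 0 + p) '' (L '' Set.range v)) =
      (fun p => y 0 + p) '' (L '' convexHull ℝ (Set.range v)) := by
    rw [LinearMap.image_convexHull]
    exact ((AffineEquiv.constVAdd ℝ _ (y 0)).toAffineMap.image_convexHull _).symm
  rw [simplexDet, hrange, himage, Set.image_add_left, measure_preimage_add,
    Measure.addHaar_image_linearMap, LinearMap.det_toLin, abs_mul,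
    abs_of_nonneg ENNReal.toReal_nonneg, ENNReal.ofReal_mul ENNReal.toReal_nonneg,
    ENNReal.ofReal_toReal (ENNReal.mul_ne_top (ENNReal.natCast_ne_top _) hfin)]
  ring

end Simplex

/-! ### The change of variables. -/

section Main

variable {n m : ℕ}

/-- The rearrangement inequality for the determinant of a simplex whose vertices are linear
combinations of `y₁, …, yₘ`. -/
theorem essSup_prod_symmDecrRearr_mul_simplexDet_le (hn : 1 ≤ n)
    {f : Fin m → EuclideanSpace ℝ (Fin n) → ℝ≥0∞} (hf : ∀ j, AEMeasurable (f j) volume)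
    (hfv : ∀ j, VanishesAtInfinity (f j)) (A : Matrix.GeneralLinearGroup (Fin m) ℝ)
    (B : Matrix (Fin (n + 1)) (Fin m) ℝ) :
    essSup (fun y : Fin m → EuclideanSpace ℝ (Fin n) =>
        (∏ j, symmDecrRearr (f j) (∑ i, (A : Matrix (Fin m) (Fin m) ℝ) i j • y i)) *
          simplexDet fun k => ∑ i, B k i • y i) volume ≤
      essSup (fun y : Fin m → EuclideanSpace ℝ (Fin n) =>
        (∏ j, f j (∑ i, (A : Matrix (Fin m) (Fin m) ℝ) i j • y i)) *
          simplexDet fun k => ∑ i, B k i • y i) volume := by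
  set S := essSup (fun y : Fin m → EuclideanSpace ℝ (Fin n) =>
        (∏ j, f j (∑ i, (A : Matrix (Fin m) (Fin m) ℝ) i j • y i)) *
          simplexDet fun k => ∑ i, B k i • y i) volume
  obtain ⟨c, hc⟩ := exists_simplexDet_eq n
  let act (M : Matrix (Fin m) (Fin m) ℝ) :
      (Fin m → EuclideanSpace ℝ (Fin n)) →ₗ[ℝ] (Fin m → EuclideanSpace ℝ (Fin n)) :=
    LinearMap.pi fun j => ∑ i, M i j • LinearMap.proj i
  have hact : ∀ M z j, act M z j = ∑ i, M i j • z i := fun M z j => by simp [act]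
  have hcomp : ∀ M N : Matrix (Fin m) (Fin m) ℝ, M * N = 1 → ∀ z, act N (act M z) = z := by
    intro M N hMN z
    ext1 j
    simp only [hact, Finset.smul_sum, smul_smul]
    rw [Finset.sum_comm]
    have : ∀ k, ∑ i, (N i j * M k i) • z k = (1 : Matrix (Fin m) (Fin m) ℝ) k j • z k := fun k => by
      rw [← hMN, Matrix.mul_apply, Finset.sum_smul]
      simp only [mul_comm]
    simp [this, Matrix.one_apply]
  have hAB : ((A⁻¹ : Matrix.GeneralLinearGroup (Fin m) ℝ) : Matrix (Fin m) (Fin m) ℝ) *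
      (A : Matrix (Fin m) (Fin m) ℝ) = 1 := A.inv_mul
  have hBA : (A : Matrix (Fin m) (Fin m) ℝ) *
      ((A⁻¹ : Matrix.GeneralLinearGroup (Fin m) ℝ) : Matrix (Fin m) (Fin m) ℝ) = 1 := A.mul_inv
  set A' := ((A⁻¹ : Matrix.GeneralLinearGroup (Fin m) ℝ) : Matrix (Fin m) (Fin m) ℝ)
  have hdet : LinearMap.det (act A') ≠ 0 := by
    have h1 : act A ∘ₗ act A' = LinearMap.id := LinearMap.ext (hcomp _ _ hAB)
    have h2 := congrArg LinearMap.det h1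
    rw [LinearMap.det_comp, LinearMap.det_id] at h2
    exact right_ne_zero_of_mul_eq_one h2
  -- This is the determinant in the variables `z = act A y`. Since `act` sums over the first matrix
  -- index, `A⁻¹` enters transposed.
  let P : (Fin m → EuclideanSpace ℝ (Fin n)) → ℝ := fun z =>
    c * (edgeMatrix fun k => ∑ i, (B * A'.transpose) k i • z i).det
  have hP : IsFiberLinear P :=
    (isFiberLinear_det_edgeMatrix.comp_sum_smul (B * A'.transpose)).const_mul c
  have hPc : Continuous P := continuous_const.mul (continuous_det_edgeMatrix.comp (by fun_prop))
  have hPs : ∀ z, ENNReal.ofReal |P z| = simplexDet fun k => ∑ i, B k i • act A' z i := by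
    intro z
    rw [hc]
    congr! 5 with k
    simp only [hact, Finset.smul_sum, smul_smul, Matrix.mul_apply, Matrix.transpose_apply,
      Finset.sum_smul]
    exact funext fun k => Finset.sum_comm
  have hS₀ : ∀ᵐ y : Fin m → EuclideanSpace ℝ (Fin n),
      (∏ j, f j (∑ i, (A : Matrix (Fin m) (Fin m) ℝ) i j • y i)) *
        (simplexDet fun k => ∑ i, B k i • y i) ≤ S := ENNReal.ae_le_essSup _
  have hS : ∀ᵐ z, (∏ j, f j (z j)) * ENNReal.ofReal |P z| ≤ S := by
    -- An invertible linear map pulls null sets back to null sets, so the a.e. bound passes to `z`.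
    filter_upwards [(Measure.LinearMap.quasiMeasurePreserving volume _ hdet).ae hS₀] with z hz
    rw [hPs]
    simp only [← hact (A : Matrix (Fin m) (Fin m) ℝ), hcomp _ _ hAB] at hz
    exact hz
  refine essSup_le_of_ae_le _ (ae_of_all _ fun y => ?_)
  have := hP.prod_symmDecrRearr_mul_le hn hPc hf hfv hS (act A y)
  rw [hPs, hcomp _ _ hBA] at this
  simpa only [hact] using this

theorem cons_zero_eq_sum_smul {E : Type*} [AddCommGroup E] [Module ℝ E] (y : Fin n → E) :
    (Fin.cons 0 y : Fin (n + 1) → E) =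
      fun k => ∑ i, Fin.cons (α := fun _ => Fin n → ℝ) 0 (1 : Matrix (Fin n) (Fin n) ℝ) k i •
        y i := by
  ext1 k
  refine Fin.cases ?_ (fun j => ?_) k
  · change 0 = ∑ i, (0 : Fin n → ℝ) i • y i
    simp
  · change y j = ∑ i, (1 : Matrix (Fin n) (Fin n) ℝ) j i • y i
    simp [Matrix.one_apply]

end Main

theorem theorem2p5 (n : ℕ) (hn : 1 ≤ n) :
    -- the inequality for `det(0, y₁, …, yₙ)` and `A ∈ GLₙ(ℝ)`
    (∀ f : Fin n → EuclideanSpace ℝ (Fin n) → ℝ≥0∞,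
      (∀ j, AEMeasurable (f j) volume) → (∀ j, VanishesAtInfinity (f j)) →
      ∀ A : Matrix.GeneralLinearGroup (Fin n) ℝ,
        essSup (fun y : Fin n → EuclideanSpace ℝ (Fin n) =>
            (∏ j, symmDecrRearr (f j) (∑ i, (A : Matrix (Fin n) (Fin n) ℝ) i j • y i)) *
              simplexDet (Fin.cons 0 y)) volume ≤
          essSup (fun y : Fin n → EuclideanSpace ℝ (Fin n) =>
            (∏ j, f j (∑ i, (A : Matrix (Fin n) (Fin n) ℝ) i j • y i)) *
              simplexDet (Fin.cons 0 y)) volume) ∧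
    -- the inequality for `det(y₁, …, yₙ₊₁)` and `A ∈ GLₙ₊₁(ℝ)`
    (∀ f : Fin (n + 1) → EuclideanSpace ℝ (Fin n) → ℝ≥0∞,
      (∀ j, AEMeasurable (f j) volume) → (∀ j, VanishesAtInfinity (f j)) →
      ∀ A : Matrix.GeneralLinearGroup (Fin (n + 1)) ℝ,
        essSup (fun y : Fin (n + 1) → EuclideanSpace ℝ (Fin n) =>
            (∏ j, symmDecrRearr (f j)
              (∑ i, (A : Matrix (Fin (n + 1)) (Fin (n + 1)) ℝ) i j • y i)) *
              simplexDet y) volume ≤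
          essSup (fun y : Fin (n + 1) → EuclideanSpace ℝ (Fin n) =>
            (∏ j, f j (∑ i, (A : Matrix (Fin (n + 1)) (Fin (n + 1)) ℝ) i j • y i)) *
              simplexDet y) volume) ∧
    -- the multilinear functional rearrangement inequality for `det(0, y₁, …, yₙ)`
    (∀ f : Fin n → EuclideanSpace ℝ (Fin n) → ℝ≥0∞,
      (∀ j, AEMeasurable (f j) volume) → (∀ j, VanishesAtInfinity (f j)) →
        essSup (fun y : Fin n → EuclideanSpace ℝ (Fin n) =>
            (∏ j, symmDecrRearr (f j) (y j)) * simplexDet (Fin.cons 0 y)) volume ≤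
          essSup (fun y : Fin n → EuclideanSpace ℝ (Fin n) =>
            (∏ j, f j (y j)) * simplexDet (Fin.cons 0 y)) volume) ∧
    -- the multilinear functional rearrangement inequality for `det(y₁, …, yₙ₊₁)`
    (∀ f : Fin (n + 1) → EuclideanSpace ℝ (Fin n) → ℝ≥0∞,
      (∀ j, AEMeasurable (f j) volume) → (∀ j, VanishesAtInfinity (f j)) →
        essSup (fun y : Fin (n + 1) → EuclideanSpace ℝ (Fin n) =>
            (∏ j, symmDecrRearr (f j) (y j)) * simplexDet y) volume ≤
          essSup (fun y : Fin (n + 1) → EuclideanSpace ℝ (Fin n) =>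
            (∏ j, f j (y j)) * simplexDet y) volume) := by

  have hid : ∀ {m : ℕ} (y : Fin m → EuclideanSpace ℝ (Fin n)),
      (fun k => ∑ i, (1 : Matrix (Fin m) (Fin m) ℝ) k i • y i) = y := fun y => by
    ext1 k; simp [Matrix.one_apply]
  have hid' : ∀ {m : ℕ} (y : Fin m → EuclideanSpace ℝ (Fin n)) (j : Fin m),
      ∑ i, ((1 : Matrix.GeneralLinearGroup (Fin m) ℝ) : Matrix (Fin m) (Fin m) ℝ) i j • y i =
        y j := fun y j => by
    simp [Matrix.one_apply]
  -- The vertices `0, y₁, …, yₙ` come from `B` equal to the identity with a zero row on top; `h2`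
  -- takes `B = 1`.
  have h1 : ∀ f : Fin n → EuclideanSpace ℝ (Fin n) → ℝ≥0∞,
      (∀ j, AEMeasurable (f j) volume) → (∀ j, VanishesAtInfinity (f j)) →
      ∀ A : Matrix.GeneralLinearGroup (Fin n) ℝ, _ ≤ _ := fun f hf hfv A =>
    essSup_prod_symmDecrRearr_mul_simplexDet_le hn hf hfv A
      (Fin.cons (α := fun _ => Fin n → ℝ) 0 (1 : Matrix (Fin n) (Fin n) ℝ))
  have h2 : ∀ f : Fin (n + 1) → EuclideanSpace ℝ (Fin n) → ℝ≥0∞,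
      (∀ j, AEMeasurable (f j) volume) → (∀ j, VanishesAtInfinity (f j)) →
      ∀ A : Matrix.GeneralLinearGroup (Fin (n + 1)) ℝ, _ ≤ _ := fun f hf hfv A =>
    essSup_prod_symmDecrRearr_mul_simplexDet_le hn hf hfv A 1
  simp only [← cons_zero_eq_sum_smul] at h1
  simp only [hid] at h2
  refine ⟨h1, h2, fun f hf hfv => ?_, fun f hf hfv => ?_⟩
  · simpa only [hid'] using h1 f hf hfv 1
  · simpa only [hid'] using h2 f hf hfv 1
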